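/- Throughout, rings are associative with identity and modules are unitary left modules unless said otherwise. For a ring $R$ and an $R$-module $C$, $\mathrm{Add}_R(C)$ (respectively $\mathrm{add}_R(C)$) is the class of $R$-modules isomorphic to direct summands of arbitrary (respectively finite) direct sums of copies of $C$. An exact sequence $\mathbf X$ of $R$-modules is $\mathrm{Hom}_R(-,\mathcal F)$-exact, for a module or class of modules $\mathcal F$, if $\mathrm{Hom}_R(\mathbf X,F)$ is exact for $F=\mathcal F$, respectively for every $F\in\mathcal F$. An $R$-module $C$ is *w-tilting* (weakly Wakamatsu tilting) if (1) $\mathrm{Ext}_R^{i}(C,C^{(I)})=0$ for all $i\ge 1$ and every set $I$; and (2) there is a $\mathrm{Hom}_R(-,\mathrm{Add}_R(C))$-exact exact sequence of $R$-modules $0\to R\to A^0\to A^1\to\cdots$ with $A^i\in\mathrm{Add}_R(C)$ for all $i\in\mathbb N$. It is *tilting* (Wakamatsu tilting) if (1) $C$ has a resolution by finitely generated projective $R$-modules; (2) $\mathrm{Ext}_R^{i}(C,C)=0$ for all $i\geq 1$; and (3) there is a $\mathrm{Hom}_R(-,C)$-exact exact sequence of $R$-modules $0\to R\to C^0\to C^1\to\cdots$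 with $C^i\in\mathrm{add}_R(C)$ for all $i\in\mathbb N$. Let $A$ and $B$ be rings, $U$ a $(B,A)$-bimodule, and $T=\begin{pmatrix}A&0\\U&B\end{pmatrix}$ the triangular matrix ring. For an $A$-module $M_1$ and a $B$-module $M_2$, let $\mathbf p(M_1,M_2)=\begin{pmatrix}M_1\\(U\otimes_A M_1)\oplus M_2\end{pmatrix}$ be the $T$-module on which $\begin{pmatrix}a&0\\u&b\end{pmatrix}$ acts by $(x,(y,z))\mapsto(ax,(u\otimes x+by,\,bz))$. Let $C_1$ be an $A$-module, $C_2$ a $B$-module, and $C=\mathbf p(C_1,C_2)$. The bimodule $U$ is *weakly $C$-compatible* if the following two conditions hold. * The complex $U\otimes_A\mathbf X_1$ is exact for every $\mathrm{Hom}_A(-,\mathrm{Add}_A(C_1))$-exact exact sequence of $A$-modules $\mathbf X_1:\ \cdots\to P_1^1\to P_1^0\to C_1^0\to C_1^1\to\cdots$ with all $P_1^i$ projective and all $C_1^i\in\mathrm{Add}_A(C_1)$. * The complex $\mathrm{Hom}_B(\mathbf X_2,U\otimes_A Y)$ is exact for every $Y\in\mathrm{Add}_A(C_1)$ and every $\mathrm{Hom}_B(-,\mathrm{Add}_B(C_2))$-exact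 exact sequence of $B$-modules $\mathbf X_2:\ \cdots\to P_2^1\to P_2^0\to C_2^0\to C_2^1\to\cdots$ with all $P_2^i$ projective and all $C_2^i\in\mathrm{Add}_B(C_2)$. **Proposition.** Assume that $U$ is weakly $C$-compatible. If $C_1$ is a w-tilting $A$-module and $C_2$ is a w-tilting $B$-module, then $\mathbf p(C_1,C_2)$ is a w-tilting $T$-module. If $C_1$ is a tilting $A$-module and $C_2$ is a tilting $B$-module, then $\mathbf p(C_1,C_2)$ is a tilting $T$-module. -/

import Mathlib

universe u

open scoped TensorProduct

noncomputable section

namespace WTilting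

/-! ### Sequences of modules, the classes `Add` and `add` -/

/-- A sequence `⋯ → X (-1) → X 0 → X 1 → ⋯` of left `R`-modules and `R`-linear maps. -/
structure ModuleSeq (R : Type u) [Ring R] where
  /-- the modules of the sequence -/
  X : ℤ → ModuleCat.{u} R
  /-- the maps of the sequence -/
  d : ∀ n : ℤ, X n →ₗ[R] X (n + 1)

/-- The sequence is exact (at every place). -/
def ModuleSeq.IsExact {R : Type u} [Ring R] (S : ModuleSeq R) : Prop :=
  ∀ n : ℤ, Function.Exact (S.d n) (S.d (n + 1))

/-- `Hom_R(-, F)` leaves the sequence exact. -/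
def ModuleSeq.IsHomExact {R : Type u} [Ring R] (S : ModuleSeq R)
    (F : Type u) [AddCommGroup F] [Module R F] : Prop :=
  ∀ n : ℤ, Function.Exact
    (fun g : S.X (n + 1 + 1) →ₗ[R] F => g ∘ₗ S.d (n + 1))
    (fun g : S.X (n + 1) →ₗ[R] F => g ∘ₗ S.d n)

/-- `M ∈ Add_R(C)`: `M` is isomorphic to a direct summand of a direct sum of copies of `C`. -/
def IsAdd (R : Type u) [Ring R] (C : Type u) [AddCommGroup C] [Module R C]
    (M : Type u) [AddCommGroup M] [Module R M] : Prop :=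
  ∃ (I : Type u) (N : ModuleCat.{u} R), Nonempty ((M × N) ≃ₗ[R] (I →₀ C))

/-- `M ∈ add_R(C)`: `M` is isomorphic to a direct summand of a finite direct sum of copies
of `C`. -/
def IsFinAdd (R : Type u) [Ring R] (C : Type u) [AddCommGroup C] [Module R C]
    (M : Type u) [AddCommGroup M] [Module R M] : Prop :=
  ∃ (k : ℕ) (N : ModuleCat.{u} R), Nonempty ((M × N) ≃ₗ[R] (Fin k → C))

/-- The sequence is `Hom_R(-, Add_R(C))`-exact. -/
def ModuleSeq.IsHomAddExact {R : Type u} [Ring R] (S : ModuleSeq R)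
    (C : Type u) [AddCommGroup C] [Module R C] : Prop :=
  ∀ F : ModuleCat.{u} R, IsAdd R C F → S.IsHomExact F

/-- The sequence has the form `0 → M → X 0 → X 1 → ⋯`, with `M` placed in degree `-1`. -/
def ModuleSeq.IsCoresolutionOf {R : Type u} [Ring R] (S : ModuleSeq R)
    (M : Type u) [AddCommGroup M] [Module R M] : Prop :=
  (∀ n : ℤ, n < -1 → Subsingleton (S.X n)) ∧ Nonempty (S.X (-1) ≃ₗ[R] M)

/-- The sequence has the form `⋯ → X (-2) → X (-1) → M → 0`, with `M` placed in degree `0`. -/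
def ModuleSeq.IsResolutionOf {R : Type u} [Ring R] (S : ModuleSeq R)
    (M : Type u) [AddCommGroup M] [Module R M] : Prop :=
  (∀ n : ℤ, 0 < n → Subsingleton (S.X n)) ∧ Nonempty (S.X 0 ≃ₗ[R] M)

/-! ### w-tilting and tilting modules -/

/-- `Ext^i_R(M, N) = 0` for every `i ≥ 1`. -/
def ExtVanish (R : Type u) [Ring R] (M N : Type u) [AddCommGroup M] [Module R M]
    [AddCommGroup N] [Module R N] : Prop :=
  ∀ i : ℕ, 1 ≤ i →
    Subsingleton (CategoryTheory.Abelian.Ext.{u} (ModuleCat.of R M) (ModuleCat.of R N) i)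

/-- Weakly Wakamatsu tilting (w-tilting) left `R`-modules. -/
structure IsWTilting (R : Type u) [Ring R] (C : Type u) [AddCommGroup C] [Module R C] :
    Prop where
  ext_vanish : ∀ I : Type u, ExtVanish R C (I →₀ C)
  exists_coresolution : ∃ S : ModuleSeq R, S.IsCoresolutionOf R ∧ S.IsExact ∧
    S.IsHomAddExact C ∧ ∀ n : ℤ, 0 ≤ n → IsAdd R C (S.X n)

/-- `M` admits a degreewise finite projective resolution, i.e. a resolution by finitely
generated projective modules. -/
def HasDegreewiseFiniteProjRes (R : Type u) [Ring R] (M : Type u) [AddCommGroup M]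
    [Module R M] : Prop :=
  ∃ S : ModuleSeq R, S.IsResolutionOf M ∧ S.IsExact ∧
    ∀ n : ℤ, n < 0 → Module.Finite R (S.X n) ∧ Module.Projective R (S.X n)

/-- Wakamatsu tilting (for short: tilting) left `R`-modules. -/
structure IsTilting (R : Type u) [Ring R] (C : Type u) [AddCommGroup C] [Module R C] :
    Prop where
  finite_resolution : HasDegreewiseFiniteProjRes R C
  ext_vanish : ExtVanish R C C
  exists_coresolution : ∃ S : ModuleSeq R, S.IsCoresolutionOf R ∧ S.IsExact ∧
    S.IsHomExact C ∧ ∀ n : ℤ, 0 ≤ n → IsFinAdd R C (S.X n)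

/-! ### The tensor product over a noncommutative ring

A `(B, A)`-bimodule `U` is given by a left `B`-module structure and a left `Aᵐᵒᵖ`-module
structure (i.e. a right `A`-module structure, `u · a = MulOpposite.op a • u`) that commute. -/

section Tensor

variable (A B U : Type u) [Ring A] [Ring B] [AddCommGroup U] [Module B U] [Module Aᵐᵒᵖ U]

/-- The `B`-submodule of `U ⊗_ℤ M` generated by all `u a ⊗ m - u ⊗ a m`. -/
def balancedRel (M : Type u) [AddCommGroup M] [Module A M] : Submodule B (U ⊗[ℤ] M) :=
  Submodule.span B
    {t | ∃ (u : U) (a : A) (m : M), t = (MulOpposite.op a • u) ⊗ₜ[ℤ] m - u ⊗ₜ[ℤ] (a • m)}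

/-- The left `B`-module `U ⊗_A M`, for a `(B, A)`-bimodule `U` and a left `A`-module `M`. -/
abbrev BiTensor (M : Type u) [AddCommGroup M] [Module A M] : Type u :=
  (U ⊗[ℤ] M) ⧸ balancedRel A B U M

variable {U} in
/-- The element `u ⊗ m` of `U ⊗_A M`. -/
def biTmul {M : Type u} [AddCommGroup M] [Module A M] (u : U) (m : M) : BiTensor A B U M :=
  Submodule.Quotient.mk (u ⊗ₜ[ℤ] m)

/-- The `B`-linear map `1_U ⊗ f : U ⊗_A M → U ⊗_A N` induced by an `A`-linear `f : M → N`. -/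
def biMap {M N : Type u} [AddCommGroup M] [Module A M] [AddCommGroup N] [Module A N]
    (f : M →ₗ[A] N) : BiTensor A B U M →ₗ[B] BiTensor A B U N :=
  Submodule.mapQ (balancedRel A B U M) (balancedRel A B U N)
    (TensorProduct.AlgebraTensorModule.lTensor B U f.toAddMonoidHom.toIntLinearMap)
    (by
      refine Submodule.span_le.2 ?_
      rintro _ ⟨u, a, m, rfl⟩
      refine Submodule.subset_span ⟨u, a, f m, ?_⟩
      simp [TensorProduct.AlgebraTensorModule.lTensor])

end Tensor

/-! ### The triangular matrix ring `T` and the functor `p` on objects -/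

/-- The elements of the triangular matrix ring with rows `(A, 0)` and `(U, B)`. -/
@[ext]
structure TriRing (A B U : Type u) where
  /-- the upper left entry -/
  a : A
  /-- the lower right entry -/
  b : B
  /-- the lower left entry -/
  u : U

namespace TriRing

section Ring

variable {A B U : Type u} [Ring A] [Ring B] [AddCommGroup U]

instance : Zero (TriRing A B U) := ⟨⟨0, 0, 0⟩⟩
instance : One (TriRing A B U) := ⟨⟨1, 1, 0⟩⟩
instance : Add (TriRing A B U) := ⟨fun s t => ⟨s.a + t.a, s.b + t.b, s.u + t.u⟩⟩
instance : Neg (TriRing A B U) := ⟨fun s => ⟨-s.a, -s.b, -s.u⟩⟩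

@[simp] theorem zero_a : (0 : TriRing A B U).a = 0 := rfl
@[simp] theorem zero_b : (0 : TriRing A B U).b = 0 := rfl
@[simp] theorem zero_u : (0 : TriRing A B U).u = 0 := rfl
@[simp] theorem one_a : (1 : TriRing A B U).a = 1 := rfl
@[simp] theorem one_b : (1 : TriRing A B U).b = 1 := rfl
@[simp] theorem one_u : (1 : TriRing A B U).u = 0 := rfl
@[simp] theorem add_a (s t : TriRing A B U) : (s + t).a = s.a + t.a := rfl
@[simp] theorem add_b (s t : TriRing A B U) : (s + t).b = s.b + t.b := rfl
@[simp] theorem add_u (s t : TriRing A B U) : (s + t).u = s.u + t.u := rfl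
@[simp] theorem neg_a (s : TriRing A B U) : (-s).a = -s.a := rfl
@[simp] theorem neg_b (s : TriRing A B U) : (-s).b = -s.b := rfl
@[simp] theorem neg_u (s : TriRing A B U) : (-s).u = -s.u := rfl
variable [Module B U] [Module Aᵐᵒᵖ U]

/-- Matrix multiplication: the lower left entry of a product is `u a' + b u'`. -/
instance : Mul (TriRing A B U) :=
  ⟨fun s t => ⟨s.a * t.a, s.b * t.b, MulOpposite.op t.a • s.u + s.b • t.u⟩⟩

@[simp] theorem mul_a (s t : TriRing A B U) : (s * t).a = s.a * t.a := rfl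
@[simp] theorem mul_b (s t : TriRing A B U) : (s * t).b = s.b * t.b := rfl
@[simp] theorem mul_u (s t : TriRing A B U) :
    (s * t).u = MulOpposite.op t.a • s.u + s.b • t.u := rfl

instance [SMulCommClass B Aᵐᵒᵖ U] : Ring (TriRing A B U) where
  add_assoc r s t := by ext <;> simp [add_assoc]
  zero_add t := by ext <;> simp
  add_zero t := by ext <;> simp
  add_comm s t := by ext <;> simp [add_comm]
  neg_add_cancel t := by ext <;> simp
  nsmul := nsmulRec
  zsmul := zsmulRec
  zero_mul t := by ext <;> simp
  mul_zero t := by ext <;> simp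
  one_mul t := by ext <;> simp
  mul_one t := by ext <;> simp
  mul_assoc r s t := by
    ext
    · simp [mul_assoc]
    · simp [mul_assoc]
    · simp [smul_add, mul_smul, add_assoc, smul_comm]
  left_distrib r s t := by
    ext
    · simp [mul_add]
    · simp [mul_add]
    · simp only [mul_u, add_u, add_a, MulOpposite.op_add, add_smul, smul_add]; abel
  right_distrib r s t := by
    ext
    · simp [add_mul]
    · simp [add_mul]
    · simp only [mul_u, add_u, add_b, add_smul, smul_add]; abel

end Ring

end TriRing

section PModule

variable (A B U : Type u) [Ring A] [Ring B] [AddCommGroup U] [Module B U] [Module Aᵐᵒᵖ U]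
  (M₁ M₂ : Type u) [AddCommGroup M₁] [Module A M₁] [AddCommGroup M₂] [Module B M₂]

/-- The module `p(M₁, M₂)`, with components `M₁` and `(U ⊗_A M₁) ⊕ M₂`. -/
def PModule : Type u := M₁ × (BiTensor A B U M₁ × M₂)

instance : AddCommGroup (PModule A B U M₁ M₂) :=
  inferInstanceAs (AddCommGroup (M₁ × (BiTensor A B U M₁ × M₂)))

variable {A B U M₁} in
theorem biTmul_add_left (u v : U) (m : M₁) :
    biTmul A B (u + v) m = biTmul A B u m + biTmul A B v m := by
  simp [biTmul, TensorProduct.add_tmul]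

variable {A B U M₁} in
theorem biTmul_add_right (u : U) (m n : M₁) :
    biTmul A B u (m + n) = biTmul A B u m + biTmul A B u n := by
  simp [biTmul, TensorProduct.tmul_add]

variable {A B U M₁} in
theorem biTmul_zero_left (m : M₁) : biTmul A B (0 : U) m = 0 := by
  simp [biTmul]

variable {A B U M₁} in
theorem biTmul_zero_right (u : U) : biTmul A B u (0 : M₁) = 0 := by
  simp [biTmul]

variable {A B U M₁} in
theorem biTmul_smul_left (b : B) (u : U) (m : M₁) :
    biTmul A B (b • u) m = b • biTmul A B u m := rfl

variable {A B U M₁} in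
theorem biTmul_op_smul (u : U) (a : A) (m : M₁) :
    biTmul A B (MulOpposite.op a • u) m = biTmul A B u (a • m) :=
  (Submodule.Quotient.eq _).2 (Submodule.subset_span ⟨u, a, m, rfl⟩)

/-- A matrix with entries `a, u, b` sends the column `(x, (y, z))` to
`(a x, (u ⊗ x + b y, b z))`: the structure map of `p(M₁, M₂)` is the inclusion of
`U ⊗_A M₁` into `(U ⊗_A M₁) ⊕ M₂`. -/
instance : SMul (TriRing A B U) (PModule A B U M₁ M₂) :=
  ⟨fun t x => (t.a • x.1, (biTmul A B t.u x.1 + t.b • x.2.1, t.b • x.2.2))⟩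

variable {A B U M₁ M₂} in
theorem PModule.smul_def (t : TriRing A B U) (x : PModule A B U M₁ M₂) :
    t • x = (t.a • x.1, (biTmul A B t.u x.1 + t.b • x.2.1, t.b • x.2.2)) := rfl

instance [SMulCommClass B Aᵐᵒᵖ U] : Module (TriRing A B U) (PModule A B U M₁ M₂) where
  one_smul x := by
    refine Prod.ext ?_ (Prod.ext ?_ ?_)
    · exact one_smul A x.1
    · change biTmul A B 0 x.1 + (1 : B) • x.2.1 = x.2.1
      rw [biTmul_zero_left, one_smul, zero_add]
    · exact one_smul B x.2.2
  mul_smul s t x := by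
    refine Prod.ext ?_ (Prod.ext ?_ ?_)
    · exact mul_smul s.a t.a x.1
    · change biTmul A B (MulOpposite.op t.a • s.u + s.b • t.u) x.1 + (s.b * t.b) • x.2.1 =
        biTmul A B s.u (t.a • x.1) + s.b • (biTmul A B t.u x.1 + t.b • x.2.1)
      rw [biTmul_add_left, biTmul_op_smul, biTmul_smul_left, smul_add, mul_smul, add_assoc]
    · exact mul_smul s.b t.b x.2.2
  smul_zero t := by
    refine Prod.ext ?_ (Prod.ext ?_ ?_)
    · exact smul_zero t.a
    · change biTmul A B t.u (0 : M₁) + t.b • (0 : BiTensor A B U M₁) = 0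
      rw [biTmul_zero_right, smul_zero, zero_add]
    · exact smul_zero t.b
  smul_add t x y := by
    refine Prod.ext ?_ (Prod.ext ?_ ?_)
    · exact smul_add t.a x.1 y.1
    · change biTmul A B t.u (x.1 + y.1) + t.b • (x.2.1 + y.2.1) =
        (biTmul A B t.u x.1 + t.b • x.2.1) + (biTmul A B t.u y.1 + t.b • y.2.1)
      rw [biTmul_add_right, smul_add]; abel
    · exact smul_add t.b x.2.2 y.2.2
  add_smul s t x := by
    refine Prod.ext ?_ (Prod.ext ?_ ?_)
    · exact add_smul s.a t.a x.1
    · change biTmul A B (s.u + t.u) x.1 + (s.b + t.b) • x.2.1 =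
        (biTmul A B s.u x.1 + s.b • x.2.1) + (biTmul A B t.u x.1 + t.b • x.2.1)
      rw [biTmul_add_left, add_smul]; abel
    · exact add_smul s.b t.b x.2.2
  zero_smul x := by
    refine Prod.ext ?_ (Prod.ext ?_ ?_)
    · exact zero_smul A x.1
    · change biTmul A B 0 x.1 + (0 : B) • x.2.1 = 0
      rw [biTmul_zero_left, zero_smul, zero_add]
    · exact zero_smul B x.2.2

/-! ### Weakly compatible bimodules -/

/-- `S` is an exact sequence `⋯ → P₁ → P₀ → C⁰ → C¹ → ⋯` which is `Hom(-, Add(C))`-exact, with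
all `Pᵢ` (placed in degree `-1 - i`) projective and all `Cⁱ` (placed in degree `i`) in
`Add(C)`. -/
structure IsGCSeq {R : Type u} [Ring R] (C : Type u) [AddCommGroup C] [Module R C]
    (S : ModuleSeq R) : Prop where
  exact : S.IsExact
  hom_exact : S.IsHomAddExact C
  projective : ∀ n : ℤ, n < 0 → Module.Projective R (S.X n)
  mem_add : ∀ n : ℤ, 0 ≤ n → IsAdd R C (S.X n)

/-- The `(B, A)`-bimodule `U` is weakly `C`-compatible, for `C = p(C₁, C₂)`. -/
structure IsWeaklyCompatible (C₁ C₂ : Type u) [AddCommGroup C₁] [Module A C₁]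
    [AddCommGroup C₂] [Module B C₂] : Prop where
  tensor_exact : ∀ S : ModuleSeq A, IsGCSeq C₁ S →
    ∀ n : ℤ, Function.Exact (biMap A B U (S.d n)) (biMap A B U (S.d (n + 1)))
  hom_exact : ∀ S : ModuleSeq B, IsGCSeq C₂ S →
    ∀ Y : ModuleCat.{u} A, IsAdd A C₁ Y → S.IsHomExact (BiTensor A B U Y)

end PModule

end WTilting

end

noncomputable section

/-! All conditions become statements about exact sequences, on which `p` can be computed
componentwise. The underlying group of `p(M₁, M₂)` is `M₁ ⊕ (U ⊗_A M₁) ⊕ M₂`, so `p(S₁, S₂)` is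
exact as soon as `S₁`, `U ⊗_A S₁` and `S₂` are. A `T`-linear map `p(M₁, M₂) → p(N₁, N₂)` is the same
as a pair `M₁ → N₁`, `M₂ → (U ⊗_A N₁) ⊕ N₂` (`exists_eq_pLift`, `pLift_injective`), so Hom-exactness
of `p(S₁, S₂)` follows from that of `S₁` into `N₁` and of `S₂` into `U ⊗_A N₁` and `N₂`. In both
cases the mixed term is what weak compatibility provides.

Ext enters only through `ModuleSeq.IsResolutionOf.extVanish_iff`: all higher Ext from `M` to `N`
vanish iff the projective resolution, augmented by `M`, is `Hom(-, N)`-exact. Hence the augmented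
resolution of `C` and the coresolution of `R` are both sequences to which compatibility applies
(`IsGCSeq`). Moreover `p` commutes with direct sums of copies and `T ≅ p(A, B)`, so `p` preserves
Add, add, projectivity and coresolutions of the regular module.

The tilting case needs one more fact: on finitely generated terms, Hom-exactness into `C` passes to
every direct sum of copies of `C`. A tilting module is therefore w-tilting, and its sequences
satisfy the Add-hypotheses of compatibility. -/

namespace WTilting

open CategoryTheory CategoryTheory.Abelian

/-! ### Computing the vanishing of `Ext` from projective resolutions -/

section Ext

variable {R : Type u} [Ring R] {M N P : Type u} [AddCommGroup M] [Module R M]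
  [AddCommGroup N] [Module R N] [AddCommGroup P] [Module R P]

/-- Every linear map from the submodule `K` of `P` to `N` extends to `P`. -/
def Extends (K : Submodule R P) (N : Type u) [AddCommGroup N] [Module R N] : Prop :=
  ∀ h : K →ₗ[R] N, ∃ h' : P →ₗ[R] N, h' ∘ₗ K.subtype = h

theorem subsingleton_ext_of_projective [Module.Projective R P] (i : ℕ) (hi : 1 ≤ i) :
    Subsingleton (Ext.{u} (ModuleCat.of R P) (ModuleCat.of R N) i) := by
  obtain ⟨j, rfl⟩ := Nat.exists_eq_add_of_le' hi
  exact Ext.subsingleton_of_projective _ _ _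

variable {g : P →ₗ[R] M} (hg : Function.Surjective g) [Module.Projective R P]

-- A class in Ext¹ comes from a map `ker g → N` composed with the extension class of `g`. If the map
-- extends to `P`, the composite vanishes.
include hg in
theorem subsingleton_ext_one_of_extends (h : Extends (LinearMap.ker g) N) :
    Subsingleton (Ext.{u} (ModuleCat.of R M) (ModuleCat.of R N) 1) := by
  refine subsingleton_of_forall_eq 0 fun x => ?_
  have hS := LinearMap.shortExact_shortComplexKer hg
  have := subsingleton_ext_of_projective (R := R) (P := P) (N := N) 1 le_rfl
  obtain ⟨y, rfl⟩ := Ext.contravariant_sequence_exact₃ hS (ModuleCat.of R N) x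
    (@Subsingleton.elim _ this _ _) (n₀ := 0) rfl
  obtain ⟨f, rfl⟩ := Ext.addEquiv₀.symm.surjective y
  obtain ⟨f', hf'⟩ := h f.hom
  have hff : f = g.shortComplexKer.f ≫ ModuleCat.ofHom f' := by
    ext1
    exact hf'.symm
  rw [Ext.addEquiv₀_symm_apply, hff, ← Ext.mk₀_comp_mk₀, hS.extClass_comp_assoc]

include hg in
theorem subsingleton_ext_succ (i : ℕ)
    (h : Subsingleton (Ext.{u} (ModuleCat.of R (LinearMap.ker g)) (ModuleCat.of R N) i)) :
    Subsingleton (Ext.{u} (ModuleCat.of R M) (ModuleCat.of R N) (i + 1)) := by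
  refine subsingleton_of_forall_eq 0 fun x => ?_
  have hS := LinearMap.shortExact_shortComplexKer hg
  have := subsingleton_ext_of_projective (R := R) (P := P) (N := N) (i + 1) (by omega)
  obtain ⟨y, rfl⟩ := Ext.contravariant_sequence_exact₃ hS (ModuleCat.of R N) x
    (@Subsingleton.elim _ this _ _) (n₀ := i) (add_comm _ _)
  rw [@Subsingleton.elim _ h y 0, Ext.comp_zero]

include hg in
theorem extVanish_ker (h : ExtVanish R M N) : ExtVanish R (LinearMap.ker g) N := by
  intro i hi
  refine subsingleton_of_forall_eq 0 fun x => ?_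
  have hS := LinearMap.shortExact_shortComplexKer hg
  have := subsingleton_ext_of_projective (R := R) (P := P) (N := N) i hi
  have h' := h (1 + i) (by omega)
  obtain ⟨y, rfl⟩ := Ext.contravariant_sequence_exact₁ hS (ModuleCat.of R N) x rfl
    (@Subsingleton.elim _ h' _ _)
  rw [@Subsingleton.elim _ this y 0, Ext.comp_zero]

-- The obstruction to extending a map from `ker g` to `P` lies in Ext¹ of `M`.
omit [Module.Projective R P] in
include hg in
theorem extends_ker (h : ExtVanish R M N) : Extends (LinearMap.ker g) N := by
  intro f
  have hS := LinearMap.shortExact_shortComplexKer hg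
  have h' := h 1 le_rfl
  obtain ⟨y, hy⟩ := Ext.contravariant_sequence_exact₁ hS (ModuleCat.of R N)
    (Ext.mk₀ (ModuleCat.ofHom f)) (n₁ := 1) rfl (@Subsingleton.elim _ h' _ _)
  obtain ⟨f', rfl⟩ := Ext.addEquiv₀.symm.surjective y
  rw [Ext.addEquiv₀_symm_apply, Ext.mk₀_comp_mk₀] at hy
  exact ⟨f'.hom, congrArg ModuleCat.Hom.hom ((Ext.mk₀_bijective _ _).1 hy)⟩

end Ext

/-! ### Hom-exactness as extension from cycles, and resolutions -/

section Sequences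

variable {R : Type u} [Ring R] {M N : Type u} [AddCommGroup M] [Module R M]
  [AddCommGroup N] [Module R N] {S : ModuleSeq R}

/-- The corestriction of a differential to the cycles. -/
def ModuleSeq.toCycles (hS : S.IsExact) (n : ℤ) : S.X n →ₗ[R] LinearMap.ker (S.d (n + 1)) :=
  (S.d n).codRestrict _ fun x => (hS n).apply_apply_eq_zero x

theorem ModuleSeq.toCycles_surjective (hS : S.IsExact) (n : ℤ) :
    Function.Surjective (ModuleSeq.toCycles hS n) := by
  rintro ⟨x, hx⟩
  obtain ⟨y, rfl⟩ := (hS n x).1 hx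
  exact ⟨y, rfl⟩

theorem ModuleSeq.ker_toCycles (hS : S.IsExact) (n : ℤ) :
    LinearMap.ker (ModuleSeq.toCycles hS n) = LinearMap.ker (S.d n) :=
  LinearMap.ker_codRestrict _ _ _

/-- A map on `X (n + 1)` that kills the image of `d n` is the same as a map on the cycles in `X (n +
2)`; it comes from `X (n + 2)` exactly when the latter extends. -/
theorem ModuleSeq.isHomExact_iff_extends (hS : S.IsExact) :
    S.IsHomExact N ↔ ∀ n, Extends (LinearMap.ker (S.d n)) N := by
  constructor
  · intro h n f
    obtain ⟨m, rfl⟩ : ∃ m, n = m + 1 + 1 := ⟨n - 2, by ring⟩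
    obtain ⟨f', hf'⟩ := (h m (f ∘ₗ ModuleSeq.toCycles hS (m + 1))).1 (by
      ext x
      have : ModuleSeq.toCycles hS (m + 1) (S.d m x) = 0 :=
        Subtype.ext ((hS m).apply_apply_eq_zero x)
      simp [this])
    refine ⟨f', LinearMap.ext fun z => ?_⟩
    obtain ⟨y, rfl⟩ := ModuleSeq.toCycles_surjective hS _ z
    exact LinearMap.congr_fun hf' y
  · intro h n f
    constructor
    · intro hf
      have hk : LinearMap.ker (ModuleSeq.toCycles hS (n + 1)) ≤ LinearMap.ker f := by
        rw [ModuleSeq.ker_toCycles]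
        intro x hx
        obtain ⟨y, rfl⟩ := (hS n x).1 hx
        exact LinearMap.congr_fun hf y
      obtain ⟨k, hk'⟩ : ∃ k : LinearMap.ker (S.d (n + 1 + 1)) →ₗ[R] N,
          k ∘ₗ ModuleSeq.toCycles hS (n + 1) = f :=
        ⟨(Submodule.liftQ _ f hk) ∘ₗ
          (LinearMap.quotKerEquivOfSurjective _
            (ModuleSeq.toCycles_surjective hS (n + 1))).symm.toLinearMap, by
          ext x
          have : (LinearMap.quotKerEquivOfSurjective _
            (ModuleSeq.toCycles_surjective hS (n + 1))).symm
              (ModuleSeq.toCycles hS (n + 1) x) = Submodule.Quotient.mk x := by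
            rw [LinearEquiv.symm_apply_eq]; rfl
          simp [this]⟩
      obtain ⟨k', rfl⟩ := h _ k
      exact ⟨k', hk'⟩
    · rintro ⟨k, rfl⟩
      ext x
      change k (S.d (n + 1) (S.d n x)) = 0
      rw [(hS n).apply_apply_eq_zero, map_zero]

theorem extends_of_subsingleton {P Q : Type u} [AddCommGroup P] [Module R P] [AddCommGroup Q]
    [Module R Q] [Subsingleton Q] (f : P →ₗ[R] Q) : Extends (LinearMap.ker f) N := by
  intro h
  refine ⟨h ∘ₗ (LinearMap.id.codRestrict _ fun x => Subsingleton.elim _ _), ?_⟩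
  ext x
  rfl

theorem ModuleSeq.IsResolutionOf.exists_surjective (hM : S.IsResolutionOf M) (hS : S.IsExact) :
    ∃ g : S.X (-1) →ₗ[R] M, Function.Surjective g ∧
      LinearMap.ker g = LinearMap.ker (S.d (-1)) := by
  obtain ⟨e⟩ : Nonempty (S.X (-1 + 1) ≃ₗ[R] M) :=
    (show (0 : ℤ) = -1 + 1 by norm_num) ▸ hM.2
  refine ⟨e.toLinearMap ∘ₗ S.d (-1), e.surjective.comp fun x => (hS (-1) x).1 ?_, ?_⟩
  · have := hM.1 (-1 + 1 + 1) (by norm_num)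
    exact Subsingleton.elim _ _
  · exact LinearEquiv.ker_comp e _

/-- Dimension shifting along the syzygies: Ext-vanishing descends to every cycle module and yields
extensions there; conversely, extensions kill each Ext¹, and the higher groups reduce to Ext¹ of
deeper syzygies. -/
theorem ModuleSeq.IsResolutionOf.extVanish_iff (hM : S.IsResolutionOf M) (hS : S.IsExact)
    (hP : ∀ n : ℤ, n < 0 → Module.Projective R (S.X n)) :
    ExtVanish R M N ↔ S.IsHomExact N := by
  obtain ⟨g, hg, hgk⟩ := hM.exists_surjective hS
  have hP1 := hP (-1) (by norm_num)
  rw [ModuleSeq.isHomExact_iff_extends hS]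
  constructor
  · intro h n
    rcases lt_or_ge n 0 with hn | hn
    · suffices H : Extends (LinearMap.ker (S.d n)) N ∧ ExtVanish R (LinearMap.ker (S.d n)) N from
        H.1
      refine Int.leInductionDown (m := -1)
        (motive := fun n _ => Extends (LinearMap.ker (S.d n)) N ∧
          ExtVanish R (LinearMap.ker (S.d n)) N) ?_ ?_ n (by omega)
      · rw [← hgk]
        exact ⟨extends_ker hg h, extVanish_ker hg h⟩
      · intro n hn ih
        obtain ⟨m, rfl⟩ : ∃ m, n = m + 1 := ⟨n - 1, by ring⟩
        have := hP m (by omega)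
        rw [add_sub_cancel_right, ← ModuleSeq.ker_toCycles hS]
        exact ⟨extends_ker (ModuleSeq.toCycles_surjective hS m) ih.2,
          extVanish_ker (ModuleSeq.toCycles_surjective hS m) ih.2⟩
    · have := hM.1 (n + 1) (by omega)
      exact extends_of_subsingleton _
  · intro h i hi
    -- All negative `n` are treated at once, because lowering `i` by one also lowers the degree of
    -- the cycles by one.
    have key : ∀ i : ℕ, 1 ≤ i → ∀ n : ℤ, n < 0 → Subsingleton
        (Ext.{u} (ModuleCat.of R (LinearMap.ker (S.d n))) (ModuleCat.of R N) i) := by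
      intro i hi
      induction i, hi using Nat.le_induction with
      | base =>
        intro n hn
        obtain ⟨m, rfl⟩ : ∃ m, n = m + 1 := ⟨n - 1, by ring⟩
        have := hP m (by omega)
        refine subsingleton_ext_one_of_extends (ModuleSeq.toCycles_surjective hS m) ?_
        rw [ModuleSeq.ker_toCycles]
        exact h m
      | succ i hi ih =>
        intro n hn
        obtain ⟨m, rfl⟩ : ∃ m, n = m + 1 := ⟨n - 1, by ring⟩
        have := hP m (by omega)
        refine subsingleton_ext_succ (ModuleSeq.toCycles_surjective hS m) i ?_
        rw [ModuleSeq.ker_toCycles]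
        exact ih m (by omega)
    obtain ⟨j, rfl⟩ := Nat.exists_eq_add_of_le' hi
    rcases Nat.eq_zero_or_pos j with rfl | hj
    · refine subsingleton_ext_one_of_extends hg ?_
      rw [hgk]
      exact h (-1)
    · refine subsingleton_ext_succ hg j ?_
      rw [hgk]
      exact key j hj (-1) (by norm_num)

/-- The iterated syzygies of `M` with respect to the canonical free covers. -/
def syzygy (R : Type u) [Ring R] (M : Type u) [AddCommGroup M] [Module R M] : ℕ → ModuleCat.{u} R
  | 0 => ModuleCat.of R M
  | k + 1 => ModuleCat.of R
      (LinearMap.ker (Finsupp.linearCombination R (id : syzygy R M k → syzygy R M k)))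

/-- The canonical free resolution of `M`. -/
def freeResolution (R : Type u) [Ring R] (M : Type u) [AddCommGroup M] [Module R M] :
    ModuleSeq R where
  X
    | Int.ofNat 0 => ModuleCat.of R M
    | Int.ofNat (_ + 1) => ModuleCat.of R PUnit.{u + 1}
    | Int.negSucc k => ModuleCat.of R (syzygy R M k →₀ R)
  d
    | Int.ofNat 0 => (0 : M →ₗ[R] PUnit.{u + 1})
    | Int.ofNat (_ + 1) => (0 : PUnit.{u + 1} →ₗ[R] PUnit.{u + 1})
    | Int.negSucc 0 => Finsupp.linearCombination R (id : M → M)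
    | Int.negSucc (k + 1) => LinearMap.comp (M₂ := syzygy R M (k + 1))
        (LinearMap.ker (Finsupp.linearCombination R
          (id : syzygy R M k → syzygy R M k))).subtype
        (Finsupp.linearCombination R (id : syzygy R M (k + 1) → syzygy R M (k + 1)))

theorem freeResolution_isResolutionOf : (freeResolution R M).IsResolutionOf M := by
  refine ⟨fun n hn => ?_, ⟨LinearEquiv.refl R M⟩⟩
  match n, hn with
  | Int.ofNat (k + 1), _ => exact inferInstanceAs (Subsingleton PUnit.{u + 1})

theorem freeResolution_projective (n : ℤ) (hn : n < 0) :
    Module.Projective R ((freeResolution R M).X n) := by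
  match n, hn with
  | Int.negSucc k, _ => exact inferInstanceAs (Module.Projective R (syzygy R M k →₀ R))

theorem freeResolution_isExact : (freeResolution R M).IsExact := by
  have hsurj : ∀ (X : Type u) [AddCommGroup X] [Module R X],
      Function.Surjective (Finsupp.linearCombination R (id : X → X)) := fun X _ _ =>
    Finsupp.linearCombination_id_surjective R X
  intro n
  match n with
  | Int.ofNat 0 => exact fun x => ⟨fun _ => ⟨0, Subsingleton.elim (α := PUnit.{u + 1}) _ _⟩, fun _ => rfl⟩
  | Int.ofNat (k + 1) =>
    exact fun x => ⟨fun _ => ⟨0, Subsingleton.elim (α := PUnit.{u + 1}) _ _⟩, fun _ => rfl⟩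
  | Int.negSucc 0 => exact fun x => ⟨fun _ => hsurj M x, fun _ => rfl⟩
  -- Degree `-2` stands apart: the next map is the augmentation onto `M`, with no inclusion of a
  -- syzygy behind it.
  | Int.negSucc 1 =>
    intro x
    constructor
    · intro hx
      obtain ⟨y, hy⟩ := hsurj (syzygy R M 1) ⟨x, hx⟩
      exact ⟨y, congrArg Subtype.val hy⟩
    · rintro ⟨y, rfl⟩
      exact (Finsupp.linearCombination R (id : syzygy R M 1 → syzygy R M 1) y).2
  | Int.negSucc (k + 2) =>
    intro x
    constructor
    · intro hx
      obtain ⟨y, hy⟩ := hsurj (syzygy R M (k + 2)) ⟨x, Subtype.ext hx⟩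
      exact ⟨y, congrArg Subtype.val hy⟩
    · rintro ⟨y, rfl⟩
      exact congrArg Subtype.val
        (Finsupp.linearCombination R (id : syzygy R M (k + 2) → syzygy R M (k + 2)) y).2

end Sequences


/-! ### Retracts -/

section Retract

variable {R : Type u} [Ring R] {C L M N : Type u} [AddCommGroup C] [Module R C]
  [AddCommGroup L] [Module R L] [AddCommGroup M] [Module R M] [AddCommGroup N] [Module R N]

/-- `M` is a retract of the `R`-module `N`. -/
def IsRetract (R : Type u) [Ring R] (M N : Type u) [AddCommGroup M] [Module R M]
    [AddCommGroup N] [Module R N] : Prop :=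
  ∃ (i : M →ₗ[R] N) (r : N →ₗ[R] M), r ∘ₗ i = LinearMap.id

theorem IsRetract.trans (h₁ : IsRetract R L M) (h₂ : IsRetract R M N) : IsRetract R L N := by
  obtain ⟨i₁, r₁, h₁⟩ := h₁
  obtain ⟨i₂, r₂, h₂⟩ := h₂
  refine ⟨i₂ ∘ₗ i₁, r₁ ∘ₗ r₂, ?_⟩
  rw [LinearMap.comp_assoc, ← LinearMap.comp_assoc i₁, h₂, LinearMap.id_comp, h₁]

theorem IsRetract.of_equiv (e : M ≃ₗ[R] N) : IsRetract R M N :=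
  ⟨e, e.symm, e.symm_comp⟩

theorem IsRetract.of_prod_equiv (e : (M × L) ≃ₗ[R] N) : IsRetract R M N := by
  refine ⟨e.toLinearMap ∘ₗ LinearMap.inl R M L, LinearMap.fst R M L ∘ₗ e.symm.toLinearMap, ?_⟩
  ext x
  simp

/-- The complement is `ker r`, by `x = i (r x) + (x - i (r x))`. -/
theorem IsRetract.exists_prod_equiv (h : IsRetract R M N) :
    ∃ L : ModuleCat.{u} R, Nonempty ((M × L) ≃ₗ[R] N) := by
  obtain ⟨i, r, h⟩ := h
  have h' : ∀ x, r (i x) = x := LinearMap.congr_fun h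
  refine ⟨ModuleCat.of R (LinearMap.ker r), ⟨LinearEquiv.ofLinearMap
    (i.coprod (LinearMap.ker r).subtype)
    (r.prod ((LinearMap.id - i ∘ₗ r).codRestrict _ fun x => by simp [h'])) ?_ ?_⟩⟩
  · ext x
    simp
  · refine LinearMap.ext fun x => Prod.ext ?_ (Subtype.ext ?_)
    · simp [h']
    · simp [h']

theorem isAdd_iff : IsAdd R C M ↔ ∃ I : Type u, IsRetract R M (I →₀ C) :=
  ⟨fun ⟨I, _, ⟨e⟩⟩ => ⟨I, .of_prod_equiv e⟩, fun ⟨I, h⟩ => ⟨I, h.exists_prod_equiv⟩⟩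

/-- Arbitrary finite index types make it possible to merge two index sets as `I ⊕ J` later. -/
theorem isFinAdd_iff :
    IsFinAdd R C M ↔ ∃ (I : Type u) (_ : Finite I), IsRetract R M (I →₀ C) := by
  constructor
  · rintro ⟨k, _, ⟨e⟩⟩
    exact ⟨ULift (Fin k), inferInstance, (IsRetract.of_prod_equiv e).trans
      (.of_equiv ((Finsupp.linearEquivFunOnFinite R C (Fin k)).symm.trans
        (Finsupp.domLCongr Equiv.ulift.symm)))⟩
  · rintro ⟨I, _, h⟩
    refine ⟨Nat.card I, (h.trans (.of_equiv ((Finsupp.domLCongr (Finite.equivFin I)).trans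
      (Finsupp.linearEquivFunOnFinite R C _)))).exists_prod_equiv⟩

theorem IsFinAdd.isAdd (h : IsFinAdd R C M) : IsAdd R C M := by
  obtain ⟨I, _, h⟩ := isFinAdd_iff.1 h
  exact isAdd_iff.2 ⟨I, h⟩

theorem isRetract_of_subsingleton [Subsingleton M] : IsRetract R M N :=
  ⟨0, 0, Subsingleton.elim _ _⟩

theorem isAdd_of_subsingleton [Subsingleton M] : IsAdd R C M :=
  isAdd_iff.2 ⟨PUnit, isRetract_of_subsingleton⟩

theorem isRetract_finsupp_self : IsRetract R C (PUnit.{u + 1} →₀ C) :=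
  .of_equiv (Finsupp.uniqueLinearEquiv R C PUnit.unit).symm

theorem IsRetract.isAdd (h : IsRetract R M C) : IsAdd R C M :=
  isAdd_iff.2 ⟨PUnit, h.trans isRetract_finsupp_self⟩

theorem isAdd_finsupp (I : Type u) : IsAdd R C (I →₀ C) :=
  isAdd_iff.2 ⟨I, .of_equiv (.refl R _)⟩

theorem isRetract_finsupp_of_injective {I J : Type u} (f : I → J) (hf : Function.Injective f) :
    IsRetract R (I →₀ C) (J →₀ C) := by
  refine ⟨Finsupp.lmapDomain C R f, Finsupp.lcomapDomain f hf, ?_⟩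
  ext1 i
  ext c j
  simp [Finsupp.lcomapDomain]

theorem IsRetract.projective [Module.Projective R N] (h : IsRetract R M N) :
    Module.Projective R M := by
  obtain ⟨i, r, h⟩ := h
  exact .of_split i r h

theorem IsRetract.finite [Module.Finite R N] (h : IsRetract R M N) : Module.Finite R M := by
  obtain ⟨i, r, h⟩ := h
  exact .of_surjective r fun x => ⟨i x, LinearMap.congr_fun h x⟩

theorem projective_iff_isAdd : Module.Projective R M ↔ IsAdd R R M := by
  rw [isAdd_iff]
  constructor
  · intro h
    obtain ⟨s, hs⟩ := Module.projective_def.1 h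
    exact ⟨M, s, Finsupp.linearCombination R id, LinearMap.ext hs⟩
  · rintro ⟨I, h⟩
    exact h.projective

theorem IsFinAdd.finite [Module.Finite R C] (h : IsFinAdd R C M) : Module.Finite R M := by
  obtain ⟨I, _, h⟩ := isFinAdd_iff.1 h
  exact h.finite

theorem finite_projective_iff_isFinAdd :
    Module.Finite R M ∧ Module.Projective R M ↔ IsFinAdd R R M := by
  constructor
  · rintro ⟨_, _⟩
    obtain ⟨n, f, hf⟩ := Module.Finite.exists_fin' R M
    obtain ⟨s, hs⟩ := Module.projective_lifting_property f LinearMap.id hf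
    obtain ⟨i, r, h⟩ : IsRetract R (Fin n → R) (ULift.{u} (Fin n) →₀ R) :=
      .of_equiv ((Finsupp.linearEquivFunOnFinite R R (Fin n)).symm.trans
        (Finsupp.domLCongr Equiv.ulift.symm))
    exact isFinAdd_iff.2 ⟨ULift (Fin n), inferInstance, .trans ⟨s, f, hs⟩ ⟨i, r, h⟩⟩
  · exact fun h => ⟨h.finite, projective_iff_isAdd.2 h.isAdd⟩

end Retract

/-! ### Hom-exactness into retracts and direct sums -/

section HomExact

variable {R : Type u} [Ring R] {C M N : Type u} [AddCommGroup C] [Module R C]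
  [AddCommGroup M] [Module R M] [AddCommGroup N] [Module R N] {S : ModuleSeq R}

theorem ModuleSeq.IsHomExact.of_isRetract (hN : S.IsHomExact N) (h : IsRetract R M N) :
    S.IsHomExact M := by
  obtain ⟨i, r, h⟩ := h
  intro n g
  constructor
  · intro hg
    obtain ⟨f, hf⟩ := (hN n (i ∘ₗ g)).1 (by
      change (i ∘ₗ g) ∘ₗ S.d n = 0
      rw [LinearMap.comp_assoc, show g ∘ₗ S.d n = 0 from hg, LinearMap.comp_zero])
    refine ⟨r ∘ₗ f, ?_⟩
    change (r ∘ₗ f) ∘ₗ S.d (n + 1) = g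
    rw [LinearMap.comp_assoc, show f ∘ₗ S.d (n + 1) = i ∘ₗ g from hf, ← LinearMap.comp_assoc, h,
      LinearMap.id_comp]
  · rintro ⟨f, rfl⟩
    have h0 : ((i ∘ₗ f) ∘ₗ S.d (n + 1)) ∘ₗ S.d n = 0 := (hN n _).2 ⟨i ∘ₗ f, rfl⟩
    change (f ∘ₗ S.d (n + 1)) ∘ₗ S.d n = 0
    rw [← LinearMap.id_comp ((f ∘ₗ S.d (n + 1)) ∘ₗ S.d n), ← h]
    change r ∘ₗ (((i ∘ₗ f) ∘ₗ S.d (n + 1)) ∘ₗ S.d n) = 0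
    rw [h0, LinearMap.comp_zero]

theorem ModuleSeq.isHomAddExact_iff :
    S.IsHomAddExact C ↔ ∀ I : Type u, S.IsHomExact (I →₀ C) := by
  constructor
  · exact fun h I => h (ModuleCat.of R (I →₀ C)) (isAdd_finsupp I)
  · intro h F hF
    obtain ⟨I, hI⟩ := isAdd_iff.1 hF
    exact (h I).of_isRetract hI

/-- A complex of finitely generated modules that is `Hom(-, C)`-exact is `Hom(-, Add(C))`-exact. -/
theorem ModuleSeq.IsHomExact.isHomAddExact (hS : S.IsExact) (h : S.IsHomExact C)
    (hfin : ∀ n, Module.Finite R (S.X n)) : S.IsHomAddExact C := by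
  classical
  rw [ModuleSeq.isHomAddExact_iff]
  intro I n g
  constructor
  · intro hg
    obtain ⟨s, hs⟩ := (hfin (n + 1)).fg_top
    -- The supports of the images of finitely many generators: `g` lands in the copies of `C`
    -- indexed by `F`, so a finite sum of componentwise lifts suffices.
    let F : Finset I := s.biUnion fun x => (g x).support
    have hF : ∀ x, g x ∈ Finsupp.supported C R (F : Set I) := by
      suffices H : (⊤ : Submodule R (S.X (n + 1))) ≤ (Finsupp.supported C R (F : Set I)).comap g
        from fun x => H trivial
      rw [← hs, Submodule.span_le]
      intro x hx i hi
      exact Finset.mem_biUnion.2 ⟨x, hx, hi⟩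
    have key : ∀ i, ∃ f : S.X (n + 1 + 1) →ₗ[R] C, f ∘ₗ S.d (n + 1) = Finsupp.lapply i ∘ₗ g :=
      fun i => (h n (Finsupp.lapply i ∘ₗ g)).1 (by
        change (Finsupp.lapply i ∘ₗ g) ∘ₗ S.d n = 0
        rw [LinearMap.comp_assoc, show g ∘ₗ S.d n = 0 from hg, LinearMap.comp_zero])
    choose f hf using key
    refine ⟨∑ i ∈ F, Finsupp.lsingle i ∘ₗ f i, LinearMap.ext fun x => Finsupp.ext fun j => ?_⟩
    have hf' : ∀ i, f i (S.d (n + 1) x) = g x i := fun i => LinearMap.congr_fun (hf i) x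
    simp only [LinearMap.comp_apply, LinearMap.sum_apply, Finsupp.lsingle_apply, hf',
      Finsupp.finsetSum_apply, Finsupp.single_apply, Finset.sum_ite_eq']
    split_ifs with hj
    · rfl
    · exact (Finsupp.notMem_support_iff.1 fun hj' => hj (hF x hj')).symm
  · rintro ⟨f, rfl⟩
    ext1 x
    change f (S.d (n + 1) (S.d n x)) = 0
    rw [(hS n).apply_apply_eq_zero, map_zero]

end HomExact

/-! ### The functor `p` -/

section Functor

set_option linter.unusedSectionVars false

variable {A B U : Type u} [Ring A] [Ring B] [AddCommGroup U] [Module B U] [Module Aᵐᵒᵖ U]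

section BiTensor

variable {L M N : Type u} [AddCommGroup L] [Module A L] [AddCommGroup M] [Module A M]
  [AddCommGroup N] [Module A N]

@[elab_as_elim]
theorem biTensor_induction {p : BiTensor A B U M → Prop} (y : BiTensor A B U M)
    (tmul : ∀ u m, p (biTmul A B u m)) (add : ∀ y z, p y → p z → p (y + z)) : p y := by
  obtain ⟨t, rfl⟩ := Submodule.Quotient.mk_surjective _ y
  induction t with
  | zero => simpa [biTmul] using tmul 0 0
  | tmul u m => exact tmul u m
  | add s t hs ht => exact add _ _ hs ht

theorem biTensor_addHom_ext {G F : Type*} [AddCommMonoid G] [FunLike F (BiTensor A B U M) G]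
    [AddMonoidHomClass F (BiTensor A B U M) G] {f g : F}
    (h : ∀ u m, f (biTmul A B u m) = g (biTmul A B u m)) : f = g := by
  refine DFunLike.ext f g fun y => biTensor_induction y h fun y z hy hz => ?_
  rw [map_add, map_add, hy, hz]

theorem biMap_biTmul (f : M →ₗ[A] N) (u : U) (m : M) :
    biMap A B U f (biTmul A B u m) = biTmul A B u (f m) := rfl

theorem biMap_comp (g : M →ₗ[A] N) (f : L →ₗ[A] M) :
    biMap A B U (g ∘ₗ f) = biMap A B U g ∘ₗ biMap A B U f :=
  biTensor_addHom_ext fun _ _ => rfl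

theorem biMap_id : biMap A B U (LinearMap.id : M →ₗ[A] M) = LinearMap.id :=
  biTensor_addHom_ext fun _ _ => rfl

instance [Subsingleton M] : Subsingleton (BiTensor A B U M) :=
  subsingleton_of_forall_eq 0 fun y => biTensor_induction y
    (fun u m => by rw [Subsingleton.elim m 0, biTmul_zero_right])
    (fun y z hy hz => by rw [hy, hz, add_zero])

end BiTensor

variable [SMulCommClass B Aᵐᵒᵖ U]
variable {L₁ M₁ N₁ L₂ M₂ N₂ : Type u} [AddCommGroup L₁] [Module A L₁] [AddCommGroup M₁]
  [Module A M₁] [AddCommGroup N₁] [Module A N₁] [AddCommGroup L₂] [Module B L₂]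
  [AddCommGroup M₂] [Module B M₂] [AddCommGroup N₂] [Module B N₂]

/-- The `T`-linear map `p(M₁, M₂) → p(N₁, N₂)` with components `M₁ → N₁` and
`M₂ → (U ⊗_A N₁) ⊕ N₂`. -/
def pLift (f : M₁ →ₗ[A] N₁) (g : M₂ →ₗ[B] BiTensor A B U N₁ × N₂) :
    PModule A B U M₁ M₂ →ₗ[TriRing A B U] PModule A B U N₁ N₂ where
  toFun x := (f x.1, (biMap A B U f x.2.1 + (g x.2.2).1, (g x.2.2).2))
  map_add' x y := by
    refine Prod.ext (map_add f x.1 y.1) (Prod.ext ?_ ?_)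
    · change biMap A B U f (x.2.1 + y.2.1) + (g (x.2.2 + y.2.2)).1 =
        (biMap A B U f x.2.1 + (g x.2.2).1) + (biMap A B U f y.2.1 + (g y.2.2).1)
      rw [map_add, map_add, Prod.fst_add]
      abel
    · change (g (x.2.2 + y.2.2)).2 = (g x.2.2).2 + (g y.2.2).2
      rw [map_add, Prod.snd_add]
  map_smul' t x := by
    refine Prod.ext (map_smul f t.a x.1) (Prod.ext ?_ ?_)
    · change biMap A B U f (biTmul A B t.u x.1 + t.b • x.2.1) + (g (t.b • x.2.2)).1 =
        biTmul A B t.u (f x.1) + t.b • (biMap A B U f x.2.1 + (g x.2.2).1)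
      rw [map_add, map_smul, map_smul, biMap_biTmul, smul_add, Prod.smul_fst, add_assoc]
    · change (g (t.b • x.2.2)).2 = t.b • (g x.2.2).2
      rw [map_smul, Prod.smul_snd]

/-- The functor `p` on morphisms. -/
def pMap (f : M₁ →ₗ[A] N₁) (g : M₂ →ₗ[B] N₂) :
    PModule A B U M₁ M₂ →ₗ[TriRing A B U] PModule A B U N₁ N₂ :=
  pLift f (LinearMap.inr B _ _ ∘ₗ g)

theorem pMap_apply (f : M₁ →ₗ[A] N₁) (g : M₂ →ₗ[B] N₂) (x : PModule A B U M₁ M₂) :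
    pMap f g x = (f x.1, (biMap A B U f x.2.1, g x.2.2)) :=
  Prod.ext rfl (Prod.ext (add_zero _) rfl)

theorem pLift_comp_pMap (g₁ : M₁ →ₗ[A] N₁) (g₂ : M₂ →ₗ[B] BiTensor A B U N₁ × N₂)
    (f₁ : L₁ →ₗ[A] M₁) (f₂ : L₂ →ₗ[B] M₂) :
    pLift g₁ g₂ ∘ₗ pMap f₁ f₂ = pLift (g₁ ∘ₗ f₁) (g₂ ∘ₗ f₂) := by
  ext1 x
  rw [LinearMap.comp_apply, pMap_apply]
  change (g₁ (f₁ x.1), (biMap A B U g₁ (biMap A B U f₁ x.2.1) + (g₂ (f₂ x.2.2)).1,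
    (g₂ (f₂ x.2.2)).2)) = (g₁ (f₁ x.1), (biMap A B U (g₁ ∘ₗ f₁) x.2.1 + (g₂ (f₂ x.2.2)).1,
    (g₂ (f₂ x.2.2)).2))
  rw [biMap_comp, LinearMap.comp_apply]

theorem pMap_comp (g₁ : M₁ →ₗ[A] N₁) (g₂ : M₂ →ₗ[B] N₂) (f₁ : L₁ →ₗ[A] M₁) (f₂ : L₂ →ₗ[B] M₂) :
    pMap (U := U) (g₁ ∘ₗ f₁) (g₂ ∘ₗ f₂) = pMap g₁ g₂ ∘ₗ pMap f₁ f₂ :=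
  (pLift_comp_pMap _ _ _ _).symm

theorem pMap_id : pMap (U := U) (LinearMap.id : M₁ →ₗ[A] M₁) (LinearMap.id : M₂ →ₗ[B] M₂) =
    LinearMap.id := by
  ext1 x
  rw [pMap_apply, biMap_id]
  rfl

/-! ### Components and linear maps of `p(M₁, M₂)` -/

section Components

variable (A B U M₁ M₂)

/-- The first component of `p(M₁, M₂)`. -/
def pFst : PModule A B U M₁ M₂ →+ M₁ := AddMonoidHom.fst M₁ (BiTensor A B U M₁ × M₂)

/-- The second component of `p(M₁, M₂)`. -/
def pSnd : PModule A B U M₁ M₂ →+ BiTensor A B U M₁ × M₂ :=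
  AddMonoidHom.snd M₁ (BiTensor A B U M₁ × M₂)

/-- The inclusion of `M₁` into `p(M₁, M₂)`. -/
def pInl : M₁ →+ PModule A B U M₁ M₂ := AddMonoidHom.inl M₁ (BiTensor A B U M₁ × M₂)

/-- The inclusion of `(U ⊗_A M₁) ⊕ M₂` into `p(M₁, M₂)`. -/
def pInr : BiTensor A B U M₁ × M₂ →+ PModule A B U M₁ M₂ :=
  AddMonoidHom.inr M₁ (BiTensor A B U M₁ × M₂)

variable {A B U M₁ M₂}

theorem pInl_add_pInr (x : PModule A B U M₁ M₂) :
    pInl A B U M₁ M₂ (pFst A B U M₁ M₂ x) + pInr A B U M₁ M₂ (pSnd A B U M₁ M₂ x) = x :=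
  Prod.ext (add_zero x.1) (zero_add x.2)

theorem smul_pInl (t : TriRing A B U) (m : M₁) :
    t • pInl A B U M₁ M₂ m =
      pInl A B U M₁ M₂ (t.a • m) + pInr A B U M₁ M₂ (biTmul A B t.u m, 0) := by
  refine Prod.ext (add_zero (t.a • m)).symm (Prod.ext ?_ ?_)
  · change biTmul A B t.u m + t.b • (0 : BiTensor A B U M₁) = 0 + biTmul A B t.u m
    rw [smul_zero, add_comm]
  · change t.b • (0 : M₂) = 0 + 0
    rw [smul_zero, add_zero]

theorem smul_pInr (t : TriRing A B U) (y : BiTensor A B U M₁ × M₂) :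
    t • pInr A B U M₁ M₂ y = pInr A B U M₁ M₂ (t.b • y) := by
  refine Prod.ext (smul_zero t.a) (Prod.ext ?_ rfl)
  change biTmul A B t.u (0 : M₁) + t.b • y.1 = t.b • y.1
  rw [biTmul_zero_right, zero_add]

theorem pFst_smul (t : TriRing A B U) (x : PModule A B U M₁ M₂) :
    pFst A B U M₁ M₂ (t • x) = t.a • pFst A B U M₁ M₂ x := rfl

theorem pSnd_smul (t : TriRing A B U) (x : PModule A B U M₁ M₂) :
    pSnd A B U M₁ M₂ (t • x) =
      (biTmul A B t.u (pFst A B U M₁ M₂ x), 0) + t.b • pSnd A B U M₁ M₂ x :=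
  Prod.ext rfl (zero_add _).symm

theorem pFst_pInl (m : M₁) : pFst A B U M₁ M₂ (pInl A B U M₁ M₂ m) = m := rfl

theorem pSnd_pInr (y : BiTensor A B U M₁ × M₂) :
    pSnd A B U M₁ M₂ (pInr A B U M₁ M₂ y) = y := rfl

theorem pFst_pInr (y : BiTensor A B U M₁ × M₂) :
    pFst A B U M₁ M₂ (pInr A B U M₁ M₂ y) = 0 := rfl

theorem pSnd_pInl (m : M₁) : pSnd A B U M₁ M₂ (pInl A B U M₁ M₂ m) = 0 := rfl

/-- The matrix whose only nonzero entry is `u` carries `m` to `u ⊗ m`. -/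
theorem pInr_mem_of_pInl_mem {p : Submodule (TriRing A B U) (PModule A B U M₁ M₂)}
    (h : ∀ m, pInl A B U M₁ M₂ m ∈ p) (y : BiTensor A B U M₁) :
    pInr A B U M₁ M₂ (y, 0) ∈ p := by
  refine biTensor_induction y (fun u m => ?_) fun y z hy hz => ?_
  · have := p.smul_mem (⟨0, 0, u⟩ : TriRing A B U) (h m)
    rwa [smul_pInl, zero_smul, map_zero, zero_add] at this
  · have := p.add_mem hy hz
    rwa [← map_add, Prod.mk_add_mk, add_zero] at this

theorem pModule_eq_top {p : Submodule (TriRing A B U) (PModule A B U M₁ M₂)}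
    (h₁ : ∀ m, pInl A B U M₁ M₂ m ∈ p) (h₂ : ∀ m, pInr A B U M₁ M₂ (0, m) ∈ p) : p = ⊤ := by
  refine eq_top_iff.2 fun x _ => ?_
  rw [← pInl_add_pInr x]
  refine p.add_mem (h₁ _) ?_
  have := p.add_mem (pInr_mem_of_pInl_mem h₁ (pSnd A B U M₁ M₂ x).1) (h₂ (pSnd A B U M₁ M₂ x).2)
  rwa [← map_add, Prod.mk_add_mk, add_zero, zero_add] at this

theorem pHom_ext {N : Type u} [AddCommGroup N] [Module (TriRing A B U) N]
    {f g : PModule A B U M₁ M₂ →ₗ[TriRing A B U] N}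
    (h₁ : ∀ m, f (pInl A B U M₁ M₂ m) = g (pInl A B U M₁ M₂ m))
    (h₂ : ∀ m, f (pInr A B U M₁ M₂ (0, m)) = g (pInr A B U M₁ M₂ (0, m))) : f = g :=
  LinearMap.eqLocus_eq_top.1 (pModule_eq_top h₁ h₂)

theorem pLift_pInl (f : M₁ →ₗ[A] N₁) (g : M₂ →ₗ[B] BiTensor A B U N₁ × N₂) (m : M₁) :
    pLift f g (pInl A B U M₁ M₂ m) = pInl A B U N₁ N₂ (f m) := by
  refine Prod.ext rfl (Prod.ext ?_ ?_)
  · change biMap A B U f 0 + (g 0).1 = 0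
    simp
  · change (g 0).2 = 0
    simp

theorem pLift_pInr (f : M₁ →ₗ[A] N₁) (g : M₂ →ₗ[B] BiTensor A B U N₁ × N₂) (m : M₂) :
    pLift f g (pInr A B U M₁ M₂ (0, m)) = pInr A B U N₁ N₂ (g m) := by
  refine Prod.ext (map_zero f) (Prod.ext ?_ rfl)
  change biMap A B U f 0 + (g m).1 = (g m).1
  simp

theorem pLift_injective {f f' : M₁ →ₗ[A] N₁} {g g' : M₂ →ₗ[B] BiTensor A B U N₁ × N₂}
    (h : pLift f g = pLift f' g') : f = f' ∧ g = g' := by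
  constructor
  · ext1 m
    have := LinearMap.congr_fun h (pInl A B U M₁ M₂ m)
    rw [pLift_pInl, pLift_pInl] at this
    exact congrArg (pFst A B U N₁ N₂) this
  · ext1 m
    have := LinearMap.congr_fun h (pInr A B U M₁ M₂ (0, m))
    rw [pLift_pInr, pLift_pInr] at this
    exact congrArg (pSnd A B U N₁ N₂) this

theorem pLift_zero : pLift (0 : M₁ →ₗ[A] N₁) (0 : M₂ →ₗ[B] BiTensor A B U N₁ × N₂) = 0 :=
  pHom_ext (fun m => by rw [pLift_pInl]; simp) (fun m => by rw [pLift_pInr]; simp)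

theorem exists_eq_pLift (h : PModule A B U M₁ M₂ →ₗ[TriRing A B U] PModule A B U N₁ N₂) :
    ∃ f g, h = pLift f g := by
  let f : M₁ →ₗ[A] N₁ :=
    { toFun := fun m => pFst A B U N₁ N₂ (h (pInl A B U M₁ M₂ m))
      map_add' := fun m m' => by simp only [map_add]
      map_smul' := fun a m => by
        have := smul_pInl (M₂ := M₂) (⟨a, 0, 0⟩ : TriRing A B U) m
        rw [biTmul_zero_left, Prod.mk_zero_zero, map_zero, add_zero] at this
        rw [← this, map_smul, pFst_smul, RingHom.id_apply] }
  let g : M₂ →ₗ[B] BiTensor A B U N₁ × N₂ :=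
    { toFun := fun m => pSnd A B U N₁ N₂ (h (pInr A B U M₁ M₂ (0, m)))
      map_add' := fun m m' => by rw [← map_add, ← map_add, ← map_add, Prod.mk_add_mk, add_zero]
      map_smul' := fun b m => by
        have := smul_pInr (⟨0, b, 0⟩ : TriRing A B U) ((0, m) : BiTensor A B U M₁ × M₂)
        rw [Prod.smul_mk, smul_zero] at this
        rw [← this, map_smul, pSnd_smul, biTmul_zero_left, Prod.mk_zero_zero, zero_add,
          RingHom.id_apply] }
  refine ⟨f, g, pHom_ext (fun m => ?_) fun m => ?_⟩
  · rw [pLift_pInl]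
    -- The idempotent with entries `1, 0, 0` fixes the image of `M₁`, so `h` of it has no second
    -- component; the other idempotent treats `M₂` in the same way.
    have h1 := smul_pInl (M₂ := M₂) (⟨1, 0, 0⟩ : TriRing A B U) m
    rw [biTmul_zero_left, Prod.mk_zero_zero, map_zero, add_zero, one_smul] at h1
    rw [← pInl_add_pInr (h (pInl A B U M₁ M₂ m))]
    change _ + pInr A B U N₁ N₂ _ = pInl A B U N₁ N₂ (pFst A B U N₁ N₂ _)
    rw [add_eq_left, ← h1, map_smul, pSnd_smul, biTmul_zero_left, Prod.mk_zero_zero, zero_add,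
      zero_smul, map_zero]
  · rw [pLift_pInr]
    have h1 := smul_pInr (⟨0, 1, 0⟩ : TriRing A B U) ((0, m) : BiTensor A B U M₁ × M₂)
    rw [one_smul] at h1
    rw [← pInl_add_pInr (h (pInr A B U M₁ M₂ (0, m)))]
    change pInl A B U N₁ N₂ _ + _ = pInr A B U N₁ N₂ (pSnd A B U N₁ N₂ _)
    rw [add_eq_right, ← h1, map_smul, pFst_smul, zero_smul, map_zero]

end Components

/-! ### Direct sums, retracts and the regular module -/

/-- The comparison map from a direct sum of copies of `p(M₁, M₂)` to `p` of the direct sums. -/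
def pFinsuppMap (I : Type u) : (I →₀ PModule A B U M₁ M₂) →ₗ[TriRing A B U]
    PModule A B U (I →₀ M₁) (I →₀ M₂) :=
  -- The auxiliary scalars are `ℕ` because `T` is not commutative.
  Finsupp.lsum ℕ fun i => pMap (Finsupp.lsingle i) (Finsupp.lsingle i)

theorem pMap_pInl (f : M₁ →ₗ[A] N₁) (g : M₂ →ₗ[B] N₂) (m : M₁) :
    pMap f g (pInl A B U M₁ M₂ m) = pInl A B U N₁ N₂ (f m) := pLift_pInl _ _ _

theorem pMap_pInr (f : M₁ →ₗ[A] N₁) (g : M₂ →ₗ[B] N₂) (m : M₂) :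
    pMap f g (pInr A B U M₁ M₂ (0, m)) = pInr A B U N₁ N₂ (0, g m) := pLift_pInr _ _ _

theorem pMap_zero : pMap (U := U) (0 : M₁ →ₗ[A] N₁) (0 : M₂ →ₗ[B] N₂) = 0 := by
  rw [pMap, LinearMap.comp_zero, pLift_zero]

/-- Applying `p` to the coordinate projections recovers each coordinate. -/
theorem pFinsuppMap_injective (I : Type u) :
    Function.Injective (pFinsuppMap (A := A) (B := B) (U := U) (M₁ := M₁) (M₂ := M₂) I) := by
  classical
  have key : ∀ i, pMap (U := U) (Finsupp.lapply i) (Finsupp.lapply i) ∘ₗ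
      pFinsuppMap (A := A) (B := B) (U := U) (M₁ := M₁) (M₂ := M₂) I = Finsupp.lapply i := by
    intro i
    refine Finsupp.lhom_ext' fun j => ?_
    have : (pMap (Finsupp.lapply i) (Finsupp.lapply i) ∘ₗ
        pFinsuppMap (A := A) (B := B) (U := U) (M₁ := M₁) (M₂ := M₂) I) ∘ₗ Finsupp.lsingle j =
        pMap (Finsupp.lapply i ∘ₗ Finsupp.lsingle j) (Finsupp.lapply i ∘ₗ Finsupp.lsingle j) := by
      rw [pMap_comp]
      ext1 x
      simp [pFinsuppMap]
    rw [this]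
    rcases eq_or_ne i j with rfl | hij
    · rw [Finsupp.lapply_comp_lsingle_same, Finsupp.lapply_comp_lsingle_same,
        Finsupp.lapply_comp_lsingle_same, pMap_id]
    · rw [Finsupp.lapply_comp_lsingle_of_ne _ _ hij, Finsupp.lapply_comp_lsingle_of_ne _ _ hij,
        Finsupp.lapply_comp_lsingle_of_ne _ _ hij, pMap_zero]
  intro x y hxy
  ext1 i
  have := congrArg (pMap (Finsupp.lapply i) (Finsupp.lapply i)) hxy
  rwa [← LinearMap.comp_apply, ← LinearMap.comp_apply, key] at this

/-- The range contains the generating copies of `M₁` and `M₂`. -/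
theorem pFinsuppMap_surjective (I : Type u) :
    Function.Surjective (pFinsuppMap (A := A) (B := B) (U := U) (M₁ := M₁) (M₂ := M₂) I) := by
  rw [← LinearMap.range_eq_top]
  have hs : ∀ i x, pFinsuppMap I (Finsupp.single i x) =
      pMap (A := A) (B := B) (U := U) (M₁ := M₁) (M₂ := M₂)
        (Finsupp.lsingle i) (Finsupp.lsingle i) x := by
    intro i x
    simp [pFinsuppMap]
  refine pModule_eq_top (fun m => ?_) fun m => ?_
  · induction m using Finsupp.induction_linear with
    | zero => rw [map_zero]; exact zero_mem _
    | add x y hx hy => rw [map_add]; exact add_mem hx hy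
    | single i c =>
      exact ⟨Finsupp.single i (pInl A B U M₁ M₂ c), by rw [hs, pMap_pInl]; rfl⟩
  · induction m using Finsupp.induction_linear with
    | zero => rw [Prod.mk_zero_zero, map_zero]; exact zero_mem _
    | add x y hx hy =>
      have := add_mem hx hy
      rwa [← map_add, Prod.mk_add_mk, add_zero] at this
    | single i c =>
      exact ⟨Finsupp.single i (pInr A B U M₁ M₂ (0, c)), by rw [hs, pMap_pInr]; rfl⟩

/-- The functor `p` commutes with direct sums of copies. -/
def pFinsuppEquiv (I : Type u) : (I →₀ PModule A B U M₁ M₂) ≃ₗ[TriRing A B U]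
    PModule A B U (I →₀ M₁) (I →₀ M₂) :=
  LinearEquiv.ofBijective (pFinsuppMap I) ⟨pFinsuppMap_injective I, pFinsuppMap_surjective I⟩

/-- The functor `p` on isomorphisms. -/
def pEquiv (e₁ : M₁ ≃ₗ[A] N₁) (e₂ : M₂ ≃ₗ[B] N₂) :
    PModule A B U M₁ M₂ ≃ₗ[TriRing A B U] PModule A B U N₁ N₂ :=
  LinearEquiv.ofLinearMap (pMap e₁.toLinearMap e₂.toLinearMap)
    (pMap e₁.symm.toLinearMap e₂.symm.toLinearMap)
    (by rw [← pMap_comp, e₁.comp_symm, e₂.comp_symm, pMap_id])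
    (by rw [← pMap_comp, e₁.symm_comp, e₂.symm_comp, pMap_id])

theorem IsRetract.pModule (h₁ : IsRetract A M₁ N₁) (h₂ : IsRetract B M₂ N₂) :
    IsRetract (TriRing A B U) (PModule A B U M₁ M₂) (PModule A B U N₁ N₂) := by
  obtain ⟨i₁, r₁, h₁⟩ := h₁
  obtain ⟨i₂, r₂, h₂⟩ := h₂
  exact ⟨pMap i₁ i₂, pMap r₁ r₂, by rw [← pMap_comp, h₁, h₂, pMap_id]⟩

/-- The two index sets may differ, so both sums are first enlarged to `I ⊕ J`. -/
theorem IsRetract.pModule_finsupp {I J : Type u} (h₁ : IsRetract A M₁ (I →₀ N₁))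
    (h₂ : IsRetract B M₂ (J →₀ N₂)) :
    IsRetract (TriRing A B U) (PModule A B U M₁ M₂) (I ⊕ J →₀ PModule A B U N₁ N₂) :=
  (IsRetract.pModule (h₁.trans (isRetract_finsupp_of_injective Sum.inl Sum.inl_injective))
    (h₂.trans (isRetract_finsupp_of_injective Sum.inr Sum.inr_injective))).trans
    (.of_equiv (pFinsuppEquiv (I ⊕ J)).symm)

theorem IsAdd.pModule (h₁ : IsAdd A N₁ M₁) (h₂ : IsAdd B N₂ M₂) :
    IsAdd (TriRing A B U) (PModule A B U N₁ N₂) (PModule A B U M₁ M₂) := by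
  obtain ⟨I, h₁⟩ := isAdd_iff.1 h₁
  obtain ⟨J, h₂⟩ := isAdd_iff.1 h₂
  exact isAdd_iff.2 ⟨I ⊕ J, h₁.pModule_finsupp h₂⟩

theorem IsFinAdd.pModule (h₁ : IsFinAdd A N₁ M₁) (h₂ : IsFinAdd B N₂ M₂) :
    IsFinAdd (TriRing A B U) (PModule A B U N₁ N₂) (PModule A B U M₁ M₂) := by
  obtain ⟨I, _, h₁⟩ := isFinAdd_iff.1 h₁
  obtain ⟨J, _, h₂⟩ := isFinAdd_iff.1 h₂
  exact isFinAdd_iff.2 ⟨I ⊕ J, inferInstance, h₁.pModule_finsupp h₂⟩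

variable (A B U) in
/-- The canonical map `U ⊗_A A → U`. -/
def biTensorSelf : BiTensor A B U A →ₗ[B] U :=
  Submodule.liftQ _
    (TensorProduct.AlgebraTensorModule.lift
      { toFun := fun u => (AddMonoidHom.mk' (fun a : A => MulOpposite.op a • u)
          fun a a' => by rw [MulOpposite.op_add, add_smul]).toIntLinearMap
        map_add' := fun u v => by
          ext a
          exact smul_add _ _ _
        map_smul' := fun b u => by
          ext a
          exact (smul_comm b (MulOpposite.op a) u).symm })
    (Submodule.span_le.2 (by
      rintro _ ⟨u, a, a', rfl⟩
      change TensorProduct.AlgebraTensorModule.lift _ _ = 0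
      rw [map_sub, sub_eq_zero]
      change MulOpposite.op a' • MulOpposite.op a • u = MulOpposite.op (a * a') • u
      rw [MulOpposite.op_mul, mul_smul]))

theorem biTensorSelf_biTmul (u : U) (a : A) :
    biTensorSelf A B U (biTmul A B u a) = MulOpposite.op a • u := rfl

variable (A B U) in
/-- The regular `T`-module is `p(A, B)`. -/
def pRegular : TriRing A B U ≃ₗ[TriRing A B U] PModule A B U A B :=
  LinearEquiv.ofBijective
    (LinearMap.toSpanSingleton _ _ (pInl A B U A B 1 + pInr A B U A B (0, 1))) (by
    have h : ∀ t : TriRing A B U, LinearMap.toSpanSingleton (TriRing A B U) (PModule A B U A B)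
        (pInl A B U A B 1 + pInr A B U A B (0, 1)) t =
        pInl A B U A B t.a + pInr A B U A B (biTmul A B t.u 1, t.b) := by
      intro t
      rw [LinearMap.toSpanSingleton_apply, smul_add, smul_pInl, smul_pInr, add_assoc, ← map_add,
        Prod.smul_mk, Prod.mk_add_mk, smul_zero, add_zero, zero_add, smul_eq_mul, smul_eq_mul,
        mul_one, mul_one]
    constructor
    · rw [injective_iff_map_eq_zero]
      intro t ht
      rw [h] at ht
      have h1 := congrArg (pFst A B U A B) ht
      have h2 := congrArg (pSnd A B U A B) ht
      rw [map_add, pFst_pInl, pFst_pInr, add_zero, map_zero] at h1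
      rw [map_add, pSnd_pInl, pSnd_pInr, zero_add, map_zero] at h2
      -- The entry `u` is recovered from `u ⊗ 1`.
      have h3 := congrArg (fun y => biTensorSelf A B U y.1) h2
      simp only [biTensorSelf_biTmul, MulOpposite.op_one, one_smul, Prod.fst_zero, map_zero] at h3
      exact TriRing.ext h1 (congrArg Prod.snd h2) h3
    · rw [← LinearMap.range_eq_top]
      refine pModule_eq_top (fun a => ⟨⟨a, 0, 0⟩, ?_⟩) fun b => ⟨⟨0, b, 0⟩, ?_⟩
      · rw [h, biTmul_zero_left, Prod.mk_zero_zero, map_zero, add_zero]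
      · rw [h, biTmul_zero_left, map_zero, zero_add])

end Functor


/-! ### Complexes to which weak compatibility applies -/

section GCSeq

variable {R : Type u} [Ring R] {C M : Type u} [AddCommGroup C] [Module R C]
  [AddCommGroup M] [Module R M] {S : ModuleSeq R}

/-- The module `C` in degree `0` and the zeros after it lie in Add; Ext-vanishing is the
Hom-exactness. -/
theorem ModuleSeq.IsResolutionOf.isGCSeq (hC : S.IsResolutionOf C) (hS : S.IsExact)
    (hP : ∀ n : ℤ, n < 0 → Module.Projective R (S.X n))
    (hext : ∀ I : Type u, ExtVanish R C (I →₀ C)) : IsGCSeq C S where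
  exact := hS
  hom_exact := ModuleSeq.isHomAddExact_iff.2 fun I => (hC.extVanish_iff hS hP).1 (hext I)
  projective := hP
  mem_add n hn := by
    rcases hn.eq_or_lt with rfl | hn
    · obtain ⟨e⟩ := hC.2
      exact (IsRetract.of_equiv e).isAdd
    · have := hC.1 n hn
      exact isAdd_of_subsingleton

/-- Here `R` itself, followed by zeros to the left, is the projective half. -/
theorem ModuleSeq.IsCoresolutionOf.isGCSeq (hR : S.IsCoresolutionOf R) (hS : S.IsExact)
    (hC : S.IsHomAddExact C) (hadd : ∀ n : ℤ, 0 ≤ n → IsAdd R C (S.X n)) : IsGCSeq C S where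
  exact := hS
  hom_exact := hC
  projective n hn := by
    rcases (Int.le_sub_one_of_lt hn).eq_or_lt with rfl | hn
    · obtain ⟨e⟩ := hR.2
      exact (IsRetract.of_equiv e).projective
    · have := hR.1 n hn
      exact (isRetract_of_subsingleton (N := R)).projective
  mem_add := hadd

theorem ModuleSeq.IsResolutionOf.finite (hM : S.IsResolutionOf M) (hS : S.IsExact)
    (hfin : ∀ n : ℤ, n < 0 → Module.Finite R (S.X n)) : Module.Finite R M := by
  obtain ⟨g, hg, -⟩ := hM.exists_surjective hS
  have := hfin (-1) (by norm_num)
  exact .of_surjective g hg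

theorem IsTilting.finite (h : IsTilting R C) : Module.Finite R C := by
  obtain ⟨S, hM, hS, hfin⟩ := h.finite_resolution
  exact hM.finite hS fun n hn => (hfin n hn).1

theorem ModuleSeq.IsCoresolutionOf.finite (hR : S.IsCoresolutionOf R) [Module.Finite R C]
    (hadd : ∀ n : ℤ, 0 ≤ n → IsFinAdd R C (S.X n)) (n : ℤ) : Module.Finite R (S.X n) := by
  rcases lt_trichotomy n (-1) with hn | rfl | hn
  · have := hR.1 n hn
    exact (isRetract_of_subsingleton (N := R)).finite
  · obtain ⟨e⟩ := hR.2
    exact (IsRetract.of_equiv e).finite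
  · exact (hadd n (by omega)).finite

theorem IsTilting.isWTilting (h : IsTilting R C) : IsWTilting R C where
  ext_vanish I := by
    obtain ⟨S, hM, hS, hfin⟩ := h.finite_resolution
    have := h.finite
    have hP := fun n hn => (hfin n hn).2
    rw [hM.extVanish_iff hS hP]
    refine ModuleSeq.isHomAddExact_iff.1 (((hM.extVanish_iff hS hP).1 h.ext_vanish).isHomAddExact
      hS fun n => ?_) I
    rcases lt_trichotomy n 0 with hn | rfl | hn
    · exact (hfin n hn).1
    · obtain ⟨e⟩ := hM.2
      exact (IsRetract.of_equiv e).finite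
    · have := hM.1 n hn
      exact (isRetract_of_subsingleton (N := R)).finite
  exists_coresolution := by
    obtain ⟨S, hR, hS, hC, hadd⟩ := h.exists_coresolution
    have := h.finite
    exact ⟨S, hR, hS, hC.isHomAddExact hS (hR.finite hadd), fun n hn => (hadd n hn).isAdd⟩

end GCSeq

/-! ### The functor `p` on sequences -/

section PSeq

variable {A B U : Type u} [Ring A] [Ring B] [AddCommGroup U] [Module B U] [Module Aᵐᵒᵖ U]
  [SMulCommClass B Aᵐᵒᵖ U]
variable {C₁ M₁ N₁ C₂ M₂ N₂ : Type u} [AddCommGroup C₁] [Module A C₁] [AddCommGroup M₁]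
  [Module A M₁] [AddCommGroup N₁] [Module A N₁] [AddCommGroup C₂] [Module B C₂]
  [AddCommGroup M₂] [Module B M₂] [AddCommGroup N₂] [Module B N₂]
variable {S₁ : ModuleSeq A} {S₂ : ModuleSeq B}

variable (U) in
/-- The sequence `p(S₁, S₂)`. -/
def pSeq (S₁ : ModuleSeq A) (S₂ : ModuleSeq B) : ModuleSeq (TriRing A B U) where
  X n := ModuleCat.of _ (PModule A B U (S₁.X n) (S₂.X n))
  d n := pMap (S₁.d n) (S₂.d n)

instance [Subsingleton M₁] [Subsingleton M₂] : Subsingleton (PModule A B U M₁ M₂) :=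
  inferInstanceAs (Subsingleton (M₁ × (BiTensor A B U M₁ × M₂)))

theorem pSeq_isExact (h₁ : S₁.IsExact) (h₂ : S₂.IsExact)
    (h : ∀ n, Function.Exact (biMap A B U (S₁.d n)) (biMap A B U (S₁.d (n + 1)))) :
    (pSeq U S₁ S₂).IsExact := by
  intro n
  change Function.Exact (pMap (U := U) (S₁.d n) (S₂.d n)) (pMap (S₁.d (n + 1)) (S₂.d (n + 1)))
  intro x
  rw [pMap_apply]
  constructor
  · intro h0
    obtain ⟨y₁, hy₁⟩ := (h₁ n x.1).1 (congrArg Prod.fst h0)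
    obtain ⟨y₂, hy₂⟩ := (h n x.2.1).1 (congrArg (fun z => z.2.1) h0)
    obtain ⟨y₃, hy₃⟩ := (h₂ n x.2.2).1 (congrArg (fun z => z.2.2) h0)
    exact ⟨(y₁, (y₂, y₃)), (pMap_apply _ _ _).trans
      (Prod.ext hy₁ (Prod.ext hy₂ hy₃))⟩
  · rintro ⟨y, rfl⟩
    rw [pMap_apply]
    exact Prod.ext ((h₁ n).apply_apply_eq_zero _) (Prod.ext ((h n).apply_apply_eq_zero _)
      ((h₂ n).apply_apply_eq_zero _))

/-- Maps into `p(N₁, N₂)` split into three components, each lifted separately. -/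
theorem pSeq_isHomExact (h₁ : S₁.IsHomExact N₁) (h₂ : S₂.IsHomExact (BiTensor A B U N₁))
    (h₃ : S₂.IsHomExact N₂) : (pSeq U S₁ S₂).IsHomExact (PModule A B U N₁ N₂) := by
  intro n h
  obtain ⟨f, g, rfl⟩ := exists_eq_pLift h
  change pLift f g ∘ₗ pMap (S₁.d n) (S₂.d n) = 0 ↔
    ∃ k : PModule A B U (S₁.X (n + 1 + 1)) (S₂.X (n + 1 + 1)) →ₗ[TriRing A B U]
      PModule A B U N₁ N₂, k ∘ₗ pMap (S₁.d (n + 1)) (S₂.d (n + 1)) = pLift f g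
  constructor
  · intro h0
    rw [pLift_comp_pMap, ← pLift_zero] at h0
    obtain ⟨hf, hg⟩ := pLift_injective h0
    obtain ⟨f', hf'⟩ := (h₁ n f).1 hf
    obtain ⟨k₁, hk₁⟩ := (h₂ n (LinearMap.fst B _ _ ∘ₗ g)).1 (by
      change LinearMap.fst B _ _ ∘ₗ (g ∘ₗ S₂.d n) = 0
      rw [hg, LinearMap.comp_zero])
    obtain ⟨k₂, hk₂⟩ := (h₃ n (LinearMap.snd B _ _ ∘ₗ g)).1 (by
      change LinearMap.snd B _ _ ∘ₗ (g ∘ₗ S₂.d n) = 0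
      rw [hg, LinearMap.comp_zero])
    refine ⟨pLift f' (k₁.prod k₂), ?_⟩
    rw [pLift_comp_pMap, show f' ∘ₗ S₁.d (n + 1) = f from hf',
      show k₁.prod k₂ ∘ₗ S₂.d (n + 1) = g from LinearMap.ext fun x =>
        Prod.ext (LinearMap.congr_fun hk₁ x) (LinearMap.congr_fun hk₂ x)]
  · rintro ⟨k, hk⟩
    obtain ⟨f', g', rfl⟩ := exists_eq_pLift k
    rw [pLift_comp_pMap] at hk
    obtain ⟨rfl, rfl⟩ := pLift_injective hk
    have e₁ : (f' ∘ₗ S₁.d (n + 1)) ∘ₗ S₁.d n = 0 := (h₁ n _).2 ⟨f', rfl⟩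
    have e₂ : (LinearMap.fst B _ _ ∘ₗ g' ∘ₗ S₂.d (n + 1)) ∘ₗ S₂.d n = 0 :=
      (h₂ n _).2 ⟨LinearMap.fst B _ _ ∘ₗ g', rfl⟩
    have e₃ : (LinearMap.snd B _ _ ∘ₗ g' ∘ₗ S₂.d (n + 1)) ∘ₗ S₂.d n = 0 :=
      (h₃ n _).2 ⟨LinearMap.snd B _ _ ∘ₗ g', rfl⟩
    rw [pLift_comp_pMap, e₁, show (g' ∘ₗ S₂.d (n + 1)) ∘ₗ S₂.d n = 0 from LinearMap.ext fun x =>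
        Prod.ext (LinearMap.congr_fun e₂ x) (LinearMap.congr_fun e₃ x), pLift_zero]

namespace IsWeaklyCompatible

variable (hU : IsWeaklyCompatible A B U C₁ C₂)

include hU

theorem pSeq_isExact (h₁ : IsGCSeq C₁ S₁) (h₂ : S₂.IsExact) : (pSeq U S₁ S₂).IsExact :=
  WTilting.pSeq_isExact h₁.exact h₂ (hU.tensor_exact S₁ h₁)

/-- It suffices to test sums of copies of `p(C₁, C₂)`, which are again values of `p`, at sums of
copies of `C₁` and `C₂`. -/
theorem pSeq_isHomAddExact (h₁ : IsGCSeq C₁ S₁) (h₂ : IsGCSeq C₂ S₂) :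
    (pSeq U S₁ S₂).IsHomAddExact (PModule A B U C₁ C₂) :=
  ModuleSeq.isHomAddExact_iff.2 fun I =>
    (pSeq_isHomExact (ModuleSeq.isHomAddExact_iff.1 h₁.hom_exact I)
      (hU.hom_exact S₂ h₂ (ModuleCat.of A (I →₀ C₁)) (isAdd_finsupp I))
      (ModuleSeq.isHomAddExact_iff.1 h₂.hom_exact I)).of_isRetract (.of_equiv (pFinsuppEquiv I))

end IsWeaklyCompatible

theorem ModuleSeq.IsResolutionOf.pSeq (h₁ : S₁.IsResolutionOf M₁) (h₂ : S₂.IsResolutionOf M₂) :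
    (pSeq U S₁ S₂).IsResolutionOf (PModule A B U M₁ M₂) := by
  obtain ⟨⟨e₁⟩, ⟨e₂⟩⟩ := And.intro h₁.2 h₂.2
  refine ⟨fun n hn => ?_, ⟨pEquiv e₁ e₂⟩⟩
  have := h₁.1 n hn
  have := h₂.1 n hn
  exact inferInstanceAs (Subsingleton (PModule A B U (S₁.X n) (S₂.X n)))

theorem ModuleSeq.IsCoresolutionOf.pSeq (h₁ : S₁.IsCoresolutionOf A)
    (h₂ : S₂.IsCoresolutionOf B) : (pSeq U S₁ S₂).IsCoresolutionOf (TriRing A B U) := by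
  obtain ⟨⟨e₁⟩, ⟨e₂⟩⟩ := And.intro h₁.2 h₂.2
  refine ⟨fun n hn => ?_, ⟨(pEquiv e₁ e₂).trans (pRegular A B U).symm⟩⟩
  have := h₁.1 n hn
  have := h₂.1 n hn
  exact inferInstanceAs (Subsingleton (PModule A B U (S₁.X n) (S₂.X n)))

/-- Projectives form the Add-class of the regular module, and `p(A, B) ≅ T`. -/
theorem pModule_projective (h₁ : Module.Projective A M₁) (h₂ : Module.Projective B M₂) :
    Module.Projective (TriRing A B U) (PModule A B U M₁ M₂) := by
  obtain ⟨I, h⟩ := isAdd_iff.1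
    ((projective_iff_isAdd.1 h₁).pModule (U := U) (projective_iff_isAdd.1 h₂))
  exact (h.trans (.of_equiv (Finsupp.mapRange.linearEquiv (pRegular A B U).symm))).projective

theorem pModule_finite_projective (h₁ : Module.Finite A M₁ ∧ Module.Projective A M₁)
    (h₂ : Module.Finite B M₂ ∧ Module.Projective B M₂) :
    Module.Finite (TriRing A B U) (PModule A B U M₁ M₂) ∧
      Module.Projective (TriRing A B U) (PModule A B U M₁ M₂) := by
  have : Module.Finite (TriRing A B U) (PModule A B U A B) :=
    (IsRetract.of_equiv (pRegular A B U).symm).finite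
  exact ⟨((finite_projective_iff_isFinAdd.1 h₁).pModule
    (finite_projective_iff_isFinAdd.1 h₂)).finite, pModule_projective h₁.2 h₂.2⟩

/-- Compatibility makes `p` of the free resolutions of `C₁` and `C₂` a projective resolution of
`p(C₁, C₂)`. -/
theorem IsWeaklyCompatible.extVanish_pModule (hU : IsWeaklyCompatible A B U C₁ C₂)
    (h₁ : ∀ I : Type u, ExtVanish A C₁ (I →₀ C₁)) (h₂ : ∀ I : Type u, ExtVanish B C₂ (I →₀ C₂))
    (F : ModuleCat.{u} (TriRing A B U)) (hF : IsAdd (TriRing A B U) (PModule A B U C₁ C₂) F) :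
    ExtVanish (TriRing A B U) (PModule A B U C₁ C₂) F := by
  have g₁ := freeResolution_isResolutionOf.isGCSeq freeResolution_isExact
    freeResolution_projective h₁
  have g₂ := freeResolution_isResolutionOf.isGCSeq freeResolution_isExact
    freeResolution_projective h₂
  rw [(freeResolution_isResolutionOf.pSeq freeResolution_isResolutionOf).extVanish_iff
    (hU.pSeq_isExact g₁ g₂.exact)
    fun n hn => pModule_projective (g₁.projective n hn) (g₂.projective n hn)]
  exact hU.pSeq_isHomAddExact g₁ g₂ F hF

theorem IsWeaklyCompatible.isWTilting_pModule (hU : IsWeaklyCompatible A B U C₁ C₂)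
    (h₁ : IsWTilting A C₁) (h₂ : IsWTilting B C₂) :
    IsWTilting (TriRing A B U) (PModule A B U C₁ C₂) where
  ext_vanish I := hU.extVanish_pModule h₁.ext_vanish h₂.ext_vanish
    (ModuleCat.of _ (I →₀ PModule A B U C₁ C₂)) (isAdd_finsupp I)
  exists_coresolution := by
    obtain ⟨S₁, hA, hS₁, hC₁, hadd₁⟩ := h₁.exists_coresolution
    obtain ⟨S₂, hB, hS₂, hC₂, hadd₂⟩ := h₂.exists_coresolution
    have g₁ := hA.isGCSeq hS₁ hC₁ hadd₁
    have g₂ := hB.isGCSeq hS₂ hC₂ hadd₂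
    exact ⟨pSeq U S₁ S₂, hA.pSeq hB, hU.pSeq_isExact g₁ hS₂, hU.pSeq_isHomAddExact g₁ g₂,
      fun n hn => (hadd₁ n hn).pModule (hadd₂ n hn)⟩

theorem IsWeaklyCompatible.isTilting_pModule (hU : IsWeaklyCompatible A B U C₁ C₂)
    (h₁ : IsTilting A C₁) (h₂ : IsTilting B C₂) :
    IsTilting (TriRing A B U) (PModule A B U C₁ C₂) where
  finite_resolution := by
    obtain ⟨S₁, hM₁, hS₁, hP₁⟩ := h₁.finite_resolution
    obtain ⟨S₂, hM₂, hS₂, hP₂⟩ := h₂.finite_resolution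
    -- Compatibility demands Ext-vanishing into all sums of copies of `C₁`, hence the passage
    -- through w-tilting.
    have g₁ := hM₁.isGCSeq hS₁ (fun n hn => (hP₁ n hn).2) h₁.isWTilting.ext_vanish
    exact ⟨pSeq U S₁ S₂, hM₁.pSeq hM₂, hU.pSeq_isExact g₁ hS₂,
      fun n hn => pModule_finite_projective (hP₁ n hn) (hP₂ n hn)⟩
  ext_vanish := hU.extVanish_pModule h₁.isWTilting.ext_vanish h₂.isWTilting.ext_vanish
    (ModuleCat.of _ (PModule A B U C₁ C₂)) (IsRetract.of_equiv (.refl _ _)).isAdd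
  exists_coresolution := by
    obtain ⟨S₁, hA, hS₁, hC₁, hadd₁⟩ := h₁.exists_coresolution
    obtain ⟨S₂, hB, hS₂, hC₂, hadd₂⟩ := h₂.exists_coresolution
    have := h₁.finite
    have := h₂.finite
    have g₁ := hA.isGCSeq hS₁ (hC₁.isHomAddExact hS₁ (hA.finite hadd₁)) fun n hn => (hadd₁ n hn).isAdd
    have g₂ := hB.isGCSeq hS₂ (hC₂.isHomAddExact hS₂ (hB.finite hadd₂)) fun n hn => (hadd₂ n hn).isAdd
    exact ⟨pSeq U S₁ S₂, hA.pSeq hB, hU.pSeq_isExact g₁ hS₂,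
      hU.pSeq_isHomAddExact g₁ g₂ (ModuleCat.of _ (PModule A B U C₁ C₂))
        (IsRetract.of_equiv (.refl _ _)).isAdd,
      fun n hn => (hadd₁ n hn).pModule (hadd₂ n hn)⟩

end PSeq

end WTilting

end

theorem mainTheorem5 {A B U C₁ C₂ : Type u} [Ring A] [Ring B]
    [AddCommGroup U] [Module B U] [Module Aᵐᵒᵖ U] [SMulCommClass B Aᵐᵒᵖ U]
    [AddCommGroup C₁] [Module A C₁] [AddCommGroup C₂] [Module B C₂]
    (hU : WTilting.IsWeaklyCompatible A B U C₁ C₂) :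
    (WTilting.IsWTilting A C₁ → WTilting.IsWTilting B C₂ →
      WTilting.IsWTilting (WTilting.TriRing A B U) (WTilting.PModule A B U C₁ C₂)) ∧
    (WTilting.IsTilting A C₁ → WTilting.IsTilting B C₂ →
      WTilting.IsTilting (WTilting.TriRing A B U) (WTilting.PModule A B U C₁ C₂)) := by
  exact ⟨hU.isWTilting_pModule, hU.isTilting_pModule⟩
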